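/- **Calculus.** Terms, taken up to renaming of bound variables, are $$t ::= x \mid t\,t \mid c\,\overline{t_j}^j \mid \lambda x.\,t \mid \mathsf{case}\ t\ \mathsf{of}\ \overline{c_i\,\overline{x_{i,j}}^j\to l_i}^i,\qquad l ::= \lambda x.\,t,$$ where $c$ ranges over constructor names and the constructors matched by a $\mathsf{case}$ are distinct; $\mathsf{let}\ \overline{x_j=t_j}^j\ \mathsf{in}\ l$ abbreviates $(\lambda \overline{x_j}^j.\,l)\,\overline{t_j}^j$, and $\mathsf{let\ rec}$ is syntactic sugar by means of a call-by-value fixed point combinator. Values are $v ::= c\,\overline{v_j}^j\mid \lambda x.\,t$. Evaluation is the usual left-to-right call-by-value reduction, with the rules $(\lambda x.t)\,v\to[x\mapsto v]t$ and $\mathsf{case}\ c_k\,\overline{v_j}^j\ \mathsf{of}\ \overline{c_i\,\overline{x_{i,j}}^j\to l_i}^i\to[\overline{x_{k,j}\mapsto v_j}^j]\,l_k$; $t{\Downarrow}$ means that $t$ evaluates to a value. Strategies $S$ and identity strategies (types) $I$ are the closed expressions $$S ::= \top\mid\bot\mid S\to S\mid\mu F_S\mid\{\overline{c_i\langle\overline{S_{i,j}}^j\rangle}^i\}\mid\{\overline{c_i\langle\overline{x_{i,j}\mapsto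 S_{i,j}}^j\rangle\to l_i}^i\},\qquad I ::= \top\mid\bot\mid I\to I\mid\mu F_I\mid\{\overline{c_i\langle\overline{I_{i,j}}^j\rangle}^i\},$$ where the constructors in a finite set $\{\cdots\}$ are distinct, $F_S=\lambda\alpha.S$ and $F_I=\lambda\alpha.I$ are given by an expression in a recursion variable, and $F(S)$ is substitution. Contexts $\Gamma$ and $\Xi$ are finite lists of assignments $x\mapsto S$ and $x\mapsto I$, respectively. **Fusion.** The judgement $\Gamma\vdash t\leadsto t'\Leftarrow S$ is defined inductively by: 1. $\Gamma\vdash x\leadsto x\Leftarrow S$ if $(x\mapsto S)\in\Gamma$; 2. $\Gamma\vdash\lambda x.t\leadsto\lambda x.t'\Leftarrow S'\to S$ if $\Gamma\cdot(x\mapsto S')\vdash t\leadsto t'\Leftarrow S$; 3. $\Gamma\vdash t_1t_2\leadsto t_1't_2'\Leftarrow S$ if $\Gamma\vdash t_1\leadsto t_1'\Leftarrow S'\to S$ and $\Gamma\vdash t_2\leadsto t_2'\Leftarrow S'$; 4. $\Gamma\vdash t\leadsto t'\Leftarrow\mu F$ if $\Gamma\vdash t\leadsto t'\Leftarrow F(\mu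 F)$, and conversely; 5. $\Gamma\vdash c\,\overline{t_j}^j\leadsto\mathsf{let}\ \overline{x_j=t_j'}^j\ \mathsf{in}\ l'\Leftarrow S$ if $(c\langle\overline{x_j\mapsto S_j}^j\rangle\to l')\in S$, $\mathrm{FV}(l')\subseteq\{\overline{x_j}^j\}$ and $\Gamma\vdash t_j\leadsto t_j'\Leftarrow S_j$ for all $j$; 6. $\Gamma\vdash c\,\overline{t_j}^j\leadsto c\,\overline{t_j'}^j\Leftarrow S$ if $(c\langle\overline{S_j}^j\rangle)\in S$ and $\Gamma\vdash t_j\leadsto t_j'\Leftarrow S_j$ for all $j$; 7. $\Gamma\vdash\mathsf{case}\ t\ \mathsf{of}\ \overline{c_i\,\overline{x_{i,j}}^j\to l_i}^i\leadsto t'\Leftarrow S$ if $\Gamma\vdash t\leadsto t'\Leftarrow\{\overline{c_i\langle\overline{x_{i,j}\mapsto S_{i,j}}^j\rangle\to l_i'}^i\}$ and, for all $i$, $\Gamma\cdot\overline{(x_{i,j}\mapsto S_{i,j})}^j\vdash l_i\leadsto l_i'\Leftarrow S$ and $\mathrm{FV}(l_i)\cup\mathrm{FV}(l_i')\subseteq\{\overline{x_{i,j}}^j\}$;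 8. $\Gamma\vdash\mathsf{case}\ t\ \mathsf{of}\ \overline{c_i\,\overline{x_{i,j}}^j\to l_i}^i\leadsto\mathsf{case}\ t'\ \mathsf{of}\ \overline{c_i\,\overline{x_{i,j}}^j\to l_i'}^i\Leftarrow S$ if $\Gamma\vdash t\leadsto t'\Leftarrow\{\overline{c_i\langle\overline{S_{i,j}}^j\rangle}^i\}$ and, for all $i$, $\Gamma\cdot\overline{(x_{i,j}\mapsto S_{i,j})}^j\vdash l_i\leadsto l_i'\Leftarrow S$; 9. $\Gamma\vdash t\leadsto t'\Leftarrow\top$ if $\Gamma\vdash t\leadsto t'\Leftarrow I$ for an identity strategy $I$. **Contextual approximation.** The typing judgement $\Xi\vdash t:I$ has the usual rules for variables, abstractions, applications, constructors and $\mathsf{case}$ over the types $I$, folding and unfolding of $\mu F_I$, and $\Xi\vdash t:\top$ whenever $\Xi\vdash t:I$. A context $C$ is a term with one hole $[\cdot]$, whose variables may be captured by the surrounding binders. The judgement $\Xi'\vdash C:(\Xi\vdash I)\to I'$ says that under $\Xi'$ the context $C$ takes terms of type $I$ under $\Xi$ to terms of type $I'$. Its rules are: $\Xi'\vdash[\cdot]:(\Xi\vdash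 I)\to I$ if $\Xi\subseteq\Xi'$; the typing rules for abstractions, applications, constructors and $\mathsf{case}$, with the hole in one of the immediate subterms (for a branch $l_i$ of a $\mathsf{case}$, in the body of the abstraction); folding and unfolding of $\mu F_I$ in the result type $I'$; and closure under composition $C[C_1[\cdot]]$. Then $\Xi\vdash t\lesssim^{\mathrm{ctx}}t':I$ means that for all $C$ and $I'$ with $\varepsilon\vdash C:(\Xi\vdash I)\to I'$, if $C[t]{\Downarrow}$ then $C[t']{\Downarrow}$. **Theorem (Soundness of Transformation).** For every typing context $\Xi$, all terms $t,t'$ and every identity strategy $I$, $$\Xi\vdash t\leadsto t'\Leftarrow I\ \Longrightarrow\ \Xi\vdash t\lesssim^{\mathrm{ctx}}t':I.$$ -/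

import Mathlib

namespace Fusion

/-- Names of data constructors. -/
abbrev ConName : Type := ℕ

/-! ### Terms

Terms are taken up to renaming of bound variables, by means of de Bruijn indices: the variable
bound most recently has index `0`.  A pattern `c x₁ … xₙ` binds `xₙ` most recently. -/

/-- Terms `t ::= x | t t | c t₁ … tₙ | λx. t | case t of {cᵢ xᵢ₁ … xᵢₙ → lᵢ}`, where every branch
`lᵢ` is an abstraction.

In `case t cs ar b` the finite set `cs` holds the constructors that are matched, the pattern for
`c ∈ cs` binds `ar c` variables, and the branch of `c` is the abstraction `lam (b c)`; so `b c`
stands under `ar c + 1` binders. -/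
inductive Term : Type
  | var (i : ℕ) : Term
  | app (t u : Term) : Term
  | con (c : ConName) (n : ℕ) (args : Fin n → Term) : Term
  | lam (t : Term) : Term
  | case (t : Term) (cs : Finset ConName) (ar : cs → ℕ) (b : cs → Term) : Term

/-- A renaming of free variables, carried under one binder. -/
def liftRen (ρ : ℕ → ℕ) : ℕ → ℕ
  | 0 => 0
  | i + 1 => ρ i + 1

namespace Term

/-- Renaming of the free variables. -/
def rename : (ℕ → ℕ) → Term → Term
  | ρ, var i => var (ρ i)
  | ρ, app t u => app (rename ρ t) (rename ρ u)
  | ρ, con c n args => con c n (fun j => rename ρ (args j))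
  | ρ, lam t => lam (rename (liftRen ρ) t)
  | ρ, case t cs ar b =>
      case (rename ρ t) cs ar (fun c => rename (liftRen^[ar c + 1] ρ) (b c))

/-- A simultaneous substitution, carried under one binder. -/
def liftSub (σ : ℕ → Term) : ℕ → Term
  | 0 => var 0
  | i + 1 => rename Nat.succ (σ i)

/-- Capture-avoiding simultaneous substitution for the free variables. -/
def subst : (ℕ → Term) → Term → Term
  | σ, var i => σ i
  | σ, app t u => app (subst σ t) (subst σ u)
  | σ, con c n args => con c n (fun j => subst σ (args j))
  | σ, lam t => lam (subst (liftSub σ) t)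
  | σ, case t cs ar b =>
      case (subst σ t) cs ar (fun c => subst (liftSub^[ar c + 1] σ) (b c))

/-- The substitution that replaces the variables `0, 1, …` by the members of a list (the head
for `0`) and drops these variables from the scope. -/
def inst : List Term → ℕ → Term
  | [], i => var i
  | v :: _, 0 => v
  | _ :: vs, i + 1 => inst vs i

/-- The free variables. -/
def FV : Term → Set ℕ
  | var i => {i}
  | app t u => FV t ∪ FV u
  | con _ _ args => ⋃ j, FV (args j)
  | lam t => {i | i + 1 ∈ FV t}
  | case t _ ar b => FV t ∪ ⋃ c, {i | i + (ar c + 1) ∈ FV (b c)}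

/-- `let x₁ = t₁; …; xₙ = tₙ in l`, that is `(λx₁. … λxₙ. l) t₁ … tₙ`. -/
def lets (n : ℕ) (t : Fin n → Term) (l : Term) : Term :=
  (List.ofFn t).foldl app (lam^[n] l)

/-- Values `v ::= c v₁ … vₙ | λx. t`. -/
inductive Value : Term → Prop
  | lam (t : Term) : Value (lam t)
  | con (c : ConName) (n : ℕ) (args : Fin n → Term) (h : ∀ j, Value (args j)) :
      Value (con c n args)

/-- One step of call-by-value evaluation, from left to right. -/
inductive Step : Term → Term → Prop
  | appL {t t' u : Term} : Step t t' → Step (app t u) (app t' u)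
  | appR {v u u' : Term} : Value v → Step u u' → Step (app v u) (app v u')
  | beta {t v : Term} : Value v → Step (app (lam t) v) (subst (inst [v]) t)
  | con {c : ConName} {n : ℕ} {args : Fin n → Term} {i : Fin n} {a : Term} :
      (∀ j, j < i → Value (args j)) → Step (args i) a →
      Step (con c n args) (con c n (Function.update args i a))
  | scrut {t t' : Term} {cs : Finset ConName} {ar : cs → ℕ} {b : cs → Term} :
      Step t t' → Step (case t cs ar b) (case t' cs ar b)
  | match {cs : Finset ConName} {ar : cs → ℕ} {b : cs → Term} (c : cs)
      {args : Fin (ar c) → Term} :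
      (∀ j, Value (args j)) →
      Step (case (con c (ar c) args) cs ar b) (subst (inst (List.ofFn args).reverse) (lam (b c)))

/-- `t⇓`: evaluation of `t` reaches a value. -/
def Terminates (t : Term) : Prop :=
  ∃ v, Value v ∧ Relation.ReflTransGen Step t v

end Term

/-! ### Fusion strategies

`Strat n` is the type of strategies with `n` free recursion variables.  The strategies proper are
the members of `Strat 0`. A strategy function `F` is a member of `Strat (n + 1)`. -/

/-- Full fusion strategies `S ::= ⊤ | ⊥ | S → S | μF | {cᵢ⟨Sᵢⱼ⟩} | {cᵢ⟨xᵢⱼ ↦ Sᵢⱼ⟩ → lᵢ}`.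

A set of constructors is given by the finite set `cs` of its members, their numbers of fields
`ar`, and the strategies of the fields.  In `fuse cs ar S b` the term attached to `c` is the
abstraction `lam (b c)`, in which the `ar c` variables of the pattern are bound. -/
inductive Strat : ℕ → Type
  | top {n : ℕ} : Strat n
  | bot {n : ℕ} : Strat n
  | arr {n : ℕ} (S T : Strat n) : Strat n
  | rvar {n : ℕ} (α : Fin n) : Strat n
  | mu {n : ℕ} (F : Strat (n + 1)) : Strat n
  | data {n : ℕ} (cs : Finset ConName) (ar : cs → ℕ) (S : (c : cs) → Fin (ar c) → Strat n) :
      Strat n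
  | fuse {n : ℕ} (cs : Finset ConName) (ar : cs → ℕ) (S : (c : cs) → Fin (ar c) → Strat n)
      (b : cs → Term) : Strat n

/-- A renaming of recursion variables, carried under one binder. -/
def liftRecRen {n m : ℕ} (ρ : Fin n → Fin m) : Fin (n + 1) → Fin (m + 1) :=
  Fin.cases 0 (fun i => (ρ i).succ)

namespace Strat

/-- Renaming of recursion variables. -/
def rename : {n m : ℕ} → (Fin n → Fin m) → Strat n → Strat m
  | _, _, _, top => top
  | _, _, _, bot => bot
  | _, _, ρ, arr S T => arr (rename ρ S) (rename ρ T)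
  | _, _, ρ, rvar α => rvar (ρ α)
  | _, _, ρ, mu F => mu (rename (liftRecRen ρ) F)
  | _, _, ρ, data cs ar S => data cs ar (fun c j => rename ρ (S c j))
  | _, _, ρ, fuse cs ar S b => fuse cs ar (fun c j => rename ρ (S c j)) b

/-- A substitution for recursion variables, carried under one binder. -/
def liftSub {n m : ℕ} (σ : Fin n → Strat m) : Fin (n + 1) → Strat (m + 1) :=
  Fin.cases (rvar 0) (fun i => rename Fin.succ (σ i))

/-- Capture-avoiding substitution for recursion variables. -/
def subst : {n m : ℕ} → (Fin n → Strat m) → Strat n → Strat m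
  | _, _, _, top => top
  | _, _, _, bot => bot
  | _, _, σ, arr S T => arr (subst σ S) (subst σ T)
  | _, _, σ, rvar α => σ α
  | _, _, σ, mu F => mu (subst (liftSub σ) F)
  | _, _, σ, data cs ar S => data cs ar (fun c j => subst σ (S c j))
  | _, _, σ, fuse cs ar S b => fuse cs ar (fun c j => subst σ (S c j)) b

/-- `F(S)`: the strategy function `F` applied to `S`. -/
def apply {n : ℕ} (F : Strat (n + 1)) (S : Strat n) : Strat n :=
  subst (Fin.cases S rvar) F

end Strat

/-- Identity strategies, or types, `I ::= ⊤ | ⊥ | I → I | μF | {cᵢ⟨Iᵢⱼ⟩}`, with `n` free recursion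
variables. -/
inductive Ty : ℕ → Type
  | top {n : ℕ} : Ty n
  | bot {n : ℕ} : Ty n
  | arr {n : ℕ} (I J : Ty n) : Ty n
  | rvar {n : ℕ} (α : Fin n) : Ty n
  | mu {n : ℕ} (F : Ty (n + 1)) : Ty n
  | data {n : ℕ} (cs : Finset ConName) (ar : cs → ℕ) (I : (c : cs) → Fin (ar c) → Ty n) : Ty n

namespace Ty

/-- Renaming of recursion variables. -/
def rename : {n m : ℕ} → (Fin n → Fin m) → Ty n → Ty m
  | _, _, _, top => top
  | _, _, _, bot => bot
  | _, _, ρ, arr I J => arr (rename ρ I) (rename ρ J)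
  | _, _, ρ, rvar α => rvar (ρ α)
  | _, _, ρ, mu F => mu (rename (liftRecRen ρ) F)
  | _, _, ρ, data cs ar I => data cs ar (fun c j => rename ρ (I c j))

/-- A substitution for recursion variables, carried under one binder. -/
def liftSub {n m : ℕ} (σ : Fin n → Ty m) : Fin (n + 1) → Ty (m + 1) :=
  Fin.cases (rvar 0) (fun i => rename Fin.succ (σ i))

/-- Capture-avoiding substitution for recursion variables. -/
def subst : {n m : ℕ} → (Fin n → Ty m) → Ty n → Ty m
  | _, _, _, top => top
  | _, _, _, bot => bot
  | _, _, σ, arr I J => arr (subst σ I) (subst σ J)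
  | _, _, σ, rvar α => σ α
  | _, _, σ, mu F => mu (subst (liftSub σ) F)
  | _, _, σ, data cs ar I => data cs ar (fun c j => subst σ (I c j))

/-- `F(I)`: the type function `F` applied to `I`. -/
def apply {n : ℕ} (F : Ty (n + 1)) (I : Ty n) : Ty n :=
  subst (Fin.cases I rvar) F

/-- The syntax of types is part of the syntax of strategies. -/
def toStrat : {n : ℕ} → Ty n → Strat n
  | _, top => .top
  | _, bot => .bot
  | _, arr I J => .arr (toStrat I) (toStrat J)
  | _, rvar α => .rvar α
  | _, mu F => .mu (toStrat F)
  | _, data cs ar I => .data cs ar (fun c j => toStrat (I c j))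

end Ty

/-! ### Fusion rules

A strategy context lists the strategies of the variables `0, 1, …`; so `Γ · (x ↦ S)` is `S :: Γ`. -/

/-- `Γ · (x₁ ↦ A₁) · … · (xₙ ↦ Aₙ)`, for contexts of strategies or of types. -/
def extend {α : Type} (Γ : List α) {n : ℕ} (A : Fin n → α) : List α :=
  (List.ofFn A).reverse ++ Γ

/-- `Γ ⊢ t ⇝ t' ⇐ S`: in context `Γ`, the term `t` rewrites into `t'` under strategy `S`. -/
inductive Fuses : List (Strat 0) → Term → Term → Strat 0 → Prop
  | var {Γ : List (Strat 0)} {i : ℕ} {S : Strat 0} :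
      Γ[i]? = some S → Fuses Γ (.var i) (.var i) S
  | lam {Γ : List (Strat 0)} {t t' : Term} {S' S : Strat 0} :
      Fuses (S' :: Γ) t t' S → Fuses Γ (.lam t) (.lam t') (.arr S' S)
  | recFold {Γ : List (Strat 0)} {t t' : Term} {F : Strat 1} :
      Fuses Γ t t' (F.apply (.mu F)) → Fuses Γ t t' (.mu F)
  | recUnfold {Γ : List (Strat 0)} {t t' : Term} {F : Strat 1} :
      Fuses Γ t t' (.mu F) → Fuses Γ t t' (F.apply (.mu F))
  | app {Γ : List (Strat 0)} {t₁ t₁' t₂ t₂' : Term} {S' S : Strat 0} :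
      Fuses Γ t₁ t₁' (.arr S' S) → Fuses Γ t₂ t₂' S' → Fuses Γ (.app t₁ t₂) (.app t₁' t₂') S
  | ctor {Γ : List (Strat 0)} {cs : Finset ConName} {ar : cs → ℕ}
      {S : (c : cs) → Fin (ar c) → Strat 0} {b' : cs → Term} (c : cs)
      {t t' : Fin (ar c) → Term} :
      (Term.lam (b' c)).FV ⊆ Set.Iio (ar c) →
      (∀ j, Fuses Γ (t j) (t' j) (S c j)) →
      Fuses Γ (.con c (ar c) t) (Term.lets (ar c) t' (.lam (b' c))) (.fuse cs ar S b')
  | ctorSkip {Γ : List (Strat 0)} {cs : Finset ConName} {ar : cs → ℕ}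
      {S : (c : cs) → Fin (ar c) → Strat 0} (c : cs) {t t' : Fin (ar c) → Term} :
      (∀ j, Fuses Γ (t j) (t' j) (S c j)) →
      Fuses Γ (.con c (ar c) t) (.con c (ar c) t') (.data cs ar S)
  | case {Γ : List (Strat 0)} {t t' : Term} {cs : Finset ConName} {ar : cs → ℕ}
      {S' : (c : cs) → Fin (ar c) → Strat 0} {b b' : cs → Term} {S : Strat 0} :
      Fuses Γ t t' (.fuse cs ar S' b') →
      (∀ c, Fuses (extend Γ (S' c)) (.lam (b c)) (.lam (b' c)) S) →
      (∀ c, (Term.lam (b c)).FV ∪ (Term.lam (b' c)).FV ⊆ Set.Iio (ar c)) →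
      Fuses Γ (.case t cs ar b) t' S
  | caseSkip {Γ : List (Strat 0)} {t t' : Term} {cs : Finset ConName} {ar : cs → ℕ}
      {S' : (c : cs) → Fin (ar c) → Strat 0} {b b' : cs → Term} {S : Strat 0} :
      Fuses Γ t t' (.data cs ar S') →
      (∀ c, Fuses (extend Γ (S' c)) (.lam (b c)) (.lam (b' c)) S) →
      Fuses Γ (.case t cs ar b) (.case t' cs ar b') S
  | top {Γ : List (Strat 0)} {t t' : Term} (I : Ty 0) :
      Fuses Γ t t' I.toStrat → Fuses Γ t t' .top

/-! ### Recursive bindings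

`let rec` is syntactic sugar, by means of a call-by-value fixed point combinator, and its fusion
rule is a derived one. -/

/-- `λf. (λx. f (λy. x x y)) (λx. f (λy. x x y))`. -/
def Term.fix : Term :=
  .lam (.app
    (.lam (.app (.var 1) (.lam (.app (.app (.var 1) (.var 1)) (.var 0)))))
    (.lam (.app (.var 1) (.lam (.app (.app (.var 1) (.var 1)) (.var 0))))))

/-- `let rec x = t₁ in t₂`. -/
def Term.letRec (t₁ t₂ : Term) : Term :=
  .app (.lam t₂) (.app Term.fix (.lam t₁))

theorem Strat.subst_rename {n m k : ℕ} (ρ : Fin n → Fin m) (σ : Fin m → Strat k) (S : Strat n) :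
    (S.rename ρ).subst σ = S.subst (σ ∘ ρ) := by
  induction S generalizing m k with
  | top => rfl
  | bot => rfl
  | rvar α => rfl
  | arr S T hS hT => simp [rename, subst, hS, hT]
  | mu F hF =>
    simp only [rename, subst, hF]
    congr 2
    funext i
    refine Fin.cases rfl (fun i => ?_) i
    simp [liftSub, liftRecRen]
  | data cs ar S hS => simp [rename, subst, hS]
  | fuse cs ar S b hS => simp [rename, subst, hS]

theorem Strat.subst_rvar {n : ℕ} (S : Strat n) : S.subst rvar = S := by
  induction S with
  | top => rfl
  | bot => rfl
  | rvar α => rfl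
  | arr S T hS hT => simp [subst, hS, hT]
  | mu F hF =>
    simp only [subst]
    rw [show liftSub rvar = rvar from ?_, hF]
    funext i
    refine Fin.cases rfl (fun i => ?_) i
    simp [liftSub, rename]
  | data cs ar S hS => simp [subst, hS]
  | fuse cs ar S b hS => simp [subst, hS]

theorem Fuses.fix (Γ : List (Strat 0)) (A B : Strat 0) :
    Fuses Γ Term.fix Term.fix (.arr (.arr (.arr A B) (.arr A B)) (.arr A B)) := by
  let F : Strat 1 := .arr (.rvar 0) ((Strat.arr A B).rename Fin.succ)
  have hF : F.apply (.mu F) = .arr (.mu F) (.arr A B) := by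
    simp only [F, Strat.apply]
    rw [Strat.subst, Strat.subst_rename]
    congr 1
    exact Strat.subst_rvar _
  have key : ∀ Δ : List (Strat 0), Fuses (.arr (.arr A B) (.arr A B) :: Δ)
      (.lam (.app (.var 1) (.lam (.app (.app (.var 1) (.var 1)) (.var 0)))))
      (.lam (.app (.var 1) (.lam (.app (.app (.var 1) (.var 1)) (.var 0)))))
      (.arr (.mu F) (.arr A B)) := by
    intro Δ
    refine .lam (.app (S' := .arr A B) (.var rfl) (.lam (.app (S' := A) (.app (S' := .mu F) ?_
      (.var rfl)) (.var rfl))))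
    rw [← hF]
    exact .recUnfold (.var rfl)
  refine .lam (.app (S' := .mu F) (key _) (.recFold ?_))
  rw [hF]
  exact key _

theorem Fuses.letRec {Γ : List (Strat 0)} {t₁ t₁' t₂ t₂' : Term} {A B S₂ : Strat 0}
    (h₁ : Fuses (.arr A B :: Γ) t₁ t₁' (.arr A B)) (h₂ : Fuses (.arr A B :: Γ) t₂ t₂' S₂) :
    Fuses Γ (Term.letRec t₁ t₂) (Term.letRec t₁' t₂') S₂ :=
  .app (.lam h₂) (.app (Fuses.fix Γ A B) (.lam h₁))

/-! ### Typing of terms and of contexts -/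

/-- `Ξ ⊢ t : I`. -/
inductive HasType : List (Ty 0) → Term → Ty 0 → Prop
  | var {Ξ : List (Ty 0)} {i : ℕ} {I : Ty 0} :
      Ξ[i]? = some I → HasType Ξ (.var i) I
  | lam {Ξ : List (Ty 0)} {t : Term} {I' I : Ty 0} :
      HasType (I' :: Ξ) t I → HasType Ξ (.lam t) (.arr I' I)
  | recFold {Ξ : List (Ty 0)} {t : Term} {F : Ty 1} :
      HasType Ξ t (F.apply (.mu F)) → HasType Ξ t (.mu F)
  | recUnfold {Ξ : List (Ty 0)} {t : Term} {F : Ty 1} :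
      HasType Ξ t (.mu F) → HasType Ξ t (F.apply (.mu F))
  | app {Ξ : List (Ty 0)} {t₁ t₂ : Term} {I' I : Ty 0} :
      HasType Ξ t₁ (.arr I' I) → HasType Ξ t₂ I' → HasType Ξ (.app t₁ t₂) I
  | ctor {Ξ : List (Ty 0)} {cs : Finset ConName} {ar : cs → ℕ}
      {I : (c : cs) → Fin (ar c) → Ty 0} (c : cs) {t : Fin (ar c) → Term} :
      (∀ j, HasType Ξ (t j) (I c j)) → HasType Ξ (.con c (ar c) t) (.data cs ar I)
  | case {Ξ : List (Ty 0)} {t : Term} {cs : Finset ConName} {ar : cs → ℕ}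
      {I' : (c : cs) → Fin (ar c) → Ty 0} {b : cs → Term} {I : Ty 0} :
      HasType Ξ t (.data cs ar I') →
      (∀ c, HasType (extend Ξ (I' c)) (.lam (b c)) I) →
      HasType Ξ (.case t cs ar b) I
  | top {Ξ : List (Ty 0)} {t : Term} {I : Ty 0} :
      HasType Ξ t I → HasType Ξ t .top

/-- Contexts: terms with one hole, whose variables the surrounding binders capture.

The hole stands for a term over a typing context of its own, which is included in what is in
scope at the hole; with indices for names, `hole ρ` records where each variable of that typing
context is found in the scope.  The entries of `b` and `args` at the position of the hole are
immaterial. -/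
inductive Ctx : Type
  | hole (ρ : ℕ → ℕ) : Ctx
  | appL (C : Ctx) (t : Term) : Ctx
  | appR (t : Term) (C : Ctx) : Ctx
  | lam (C : Ctx) : Ctx
  | scrut (C : Ctx) (cs : Finset ConName) (ar : cs → ℕ) (b : cs → Term) : Ctx
  | branch (t : Term) (cs : Finset ConName) (ar : cs → ℕ) (b : cs → Term) (i : cs) (C : Ctx) : Ctx
  | con (c : ConName) (n : ℕ) (args : Fin n → Term) (i : Fin n) (C : Ctx) : Ctx

namespace Ctx

/-- `C[t]`. -/
def plug : Ctx → Term → Term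
  | hole ρ, u => u.rename ρ
  | appL C t, u => .app (plug C u) t
  | appR t C, u => .app t (plug C u)
  | lam C, u => .lam (plug C u)
  | scrut C cs ar b, u => .case (plug C u) cs ar b
  | branch t cs ar b i C, u => .case t cs ar (Function.update b i (plug C u))
  | con c n args i C, u => .con c n (Function.update args i (plug C u))

/-- Renaming of the free variables of a context. -/
def rename : (ℕ → ℕ) → Ctx → Ctx
  | ρ, hole ρ' => hole (ρ ∘ ρ')
  | ρ, appL C t => appL (rename ρ C) (t.rename ρ)
  | ρ, appR t C => appR (t.rename ρ) (rename ρ C)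
  | ρ, lam C => lam (rename (liftRen ρ) C)
  | ρ, scrut C cs ar b =>
      scrut (rename ρ C) cs ar (fun c => (b c).rename (liftRen^[ar c + 1] ρ))
  | ρ, branch t cs ar b i C =>
      branch (t.rename ρ) cs ar (fun c => (b c).rename (liftRen^[ar c + 1] ρ)) i
        (rename (liftRen^[ar i + 1] ρ) C)
  | ρ, con c n args i C => con c n (fun j => (args j).rename ρ) i (rename ρ C)

/-- `C[C₁[·]]`. -/
def comp : Ctx → Ctx → Ctx
  | hole ρ, C₁ => rename ρ C₁
  | appL C t, C₁ => appL (comp C C₁) t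
  | appR t C, C₁ => appR t (comp C C₁)
  | lam C, C₁ => lam (comp C C₁)
  | scrut C cs ar b, C₁ => scrut (comp C C₁) cs ar b
  | branch t cs ar b i C, C₁ => branch t cs ar b i (comp C C₁)
  | con c n args i C, C₁ => con c n args i (comp C C₁)

end Ctx

/-- `Ξ ⊆ Ξ'`, where the variable `i` of `Ξ` is the variable `ρ i` of `Ξ'`. -/
def Included (ρ : ℕ → ℕ) (Ξ Ξ' : List (Ty 0)) : Prop :=
  Function.Injective ρ ∧ ∀ (i : ℕ) (I : Ty 0), Ξ[i]? = some I → Ξ'[ρ i]? = some I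

/-- `CtxHasType Ξ' C Ξ I I'` is `Ξ' ⊢ C : (Ξ ⊢ I) → I'`: under `Ξ'`, the context `C` has a hole for
terms of type `I` under `Ξ`, and yields terms of type `I'`.

In the rules for binders (`lam` and `branch`), `Ξ` is any typing context for the hole; in
particular it may end with the variables bound there. -/
inductive CtxHasType : List (Ty 0) → Ctx → List (Ty 0) → Ty 0 → Ty 0 → Prop
  | id {Ξ Ξ' : List (Ty 0)} {ρ : ℕ → ℕ} {I : Ty 0} :
      Included ρ Ξ Ξ' → CtxHasType Ξ' (.hole ρ) Ξ I I
  | app₁ {Ξ Ξ' : List (Ty 0)} {C : Ctx} {t : Term} {I I₁ I₂ : Ty 0} :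
      CtxHasType Ξ' C Ξ I (.arr I₁ I₂) → HasType Ξ' t I₁ → CtxHasType Ξ' (.appL C t) Ξ I I₂
  | app₂ {Ξ Ξ' : List (Ty 0)} {C : Ctx} {t : Term} {I I₁ I₂ : Ty 0} :
      HasType Ξ' t (.arr I₁ I₂) → CtxHasType Ξ' C Ξ I I₁ → CtxHasType Ξ' (.appR t C) Ξ I I₂
  | lam {Ξ Ξ' : List (Ty 0)} {C : Ctx} {I I₁ I₂ : Ty 0} :
      CtxHasType (I₁ :: Ξ') C Ξ I I₂ → CtxHasType Ξ' (.lam C) Ξ I (.arr I₁ I₂)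
  | case₁ {Ξ Ξ' : List (Ty 0)} {C : Ctx} {cs : Finset ConName} {ar : cs → ℕ}
      {J : (c : cs) → Fin (ar c) → Ty 0} {b : cs → Term} {I I' : Ty 0} :
      CtxHasType Ξ' C Ξ I (.data cs ar J) →
      (∀ c, HasType (extend Ξ' (J c)) (.lam (b c)) I') →
      CtxHasType Ξ' (.scrut C cs ar b) Ξ I I'
  | case₂ {Ξ Ξ' : List (Ty 0)} {t : Term} {cs : Finset ConName} {ar : cs → ℕ}
      {J : (c : cs) → Fin (ar c) → Ty 0} {b : cs → Term} {i : cs} {C : Ctx} {I I' : Ty 0} :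
      HasType Ξ' t (.data cs ar J) →
      (∀ c, c ≠ i → HasType (extend Ξ' (J c)) (.lam (b c)) I') →
      CtxHasType (extend Ξ' (J i)) (.lam C) Ξ I I' →
      CtxHasType Ξ' (.branch t cs ar b i C) Ξ I I'
  | ctor {Ξ Ξ' : List (Ty 0)} {cs : Finset ConName} {ar : cs → ℕ}
      {J : (c : cs) → Fin (ar c) → Ty 0} (c : cs) {args : Fin (ar c) → Term} {i : Fin (ar c)}
      {C : Ctx} {I : Ty 0} :
      CtxHasType Ξ' C Ξ I (J c i) →
      (∀ j, j ≠ i → HasType Ξ' (args j) (J c j)) →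
      CtxHasType Ξ' (.con c (ar c) args i C) Ξ I (.data cs ar J)
  | recFold {Ξ Ξ' : List (Ty 0)} {C : Ctx} {I : Ty 0} {F : Ty 1} :
      CtxHasType Ξ' C Ξ I (F.apply (.mu F)) → CtxHasType Ξ' C Ξ I (.mu F)
  | recUnfold {Ξ Ξ' : List (Ty 0)} {C : Ctx} {I : Ty 0} {F : Ty 1} :
      CtxHasType Ξ' C Ξ I (.mu F) → CtxHasType Ξ' C Ξ I (F.apply (.mu F))
  | comp {Ξ Ξ₁ Ξ' : List (Ty 0)} {C C₁ : Ctx} {I I₁ I' : Ty 0} :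
      CtxHasType Ξ' C Ξ₁ I₁ I' → CtxHasType Ξ₁ C₁ Ξ I I₁ → CtxHasType Ξ' (C.comp C₁) Ξ I I'

/-- Contextual approximation `Ξ ⊢ t₁ ≲ t₂ : I`. -/
def CtxApprox (Ξ : List (Ty 0)) (t₁ t₂ : Term) (I : Ty 0) : Prop :=
  ∀ (C : Ctx) (I' : Ty 0), CtxHasType [] C Ξ I I' →
    (C.plug t₁).Terminates → (C.plug t₂).Terminates

end Fusion

namespace Fusion

/-! ### Substitution -/

namespace Term

/-! The proof uses a step-indexed logical relation between values, indexed by strategies. `ValRel k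
S v v'` says that `v'` simulates `v` at `S` for `k` steps; `TermRel` extends it to terms by counting
the steps of the left side only, so it is a one-sided approximation. At `data`, both sides carry the
same constructor and related fields. At `fuse`, the left side is a constructor value, while the
right side is the branch attached to that constructor, already instantiated with related fields.
Thus a fused constructor has performed the match in advance, and a fused `case` can be erased.

Recursion variables may occur to the left of arrows, so recursion on the strategy is unavailable.
Function arguments and constructor fields are instead compared only at indices below `k`. Each beta
or match step on the left pays for this decrease.

Every fusion rule preserves the relation under related substitutions (`Fuses.semFuses`); the side
conditions on free variables let a branch be moved to the place of the constructor. The skip rules,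
read on types, show that well-typed terms approximate themselves (`HasType.semApprox`) and that
typed contexts preserve approximation (`CtxHasType.semApprox`). For closing contexts, relatedness at
the index equal to the number of steps taken gives termination (`SemFuses.terminates`). -/

theorem liftRen_comp (ρ ρ' : ℕ → ℕ) : liftRen ρ' ∘ liftRen ρ = liftRen (ρ' ∘ ρ) := by
  funext i
  cases i <;> rfl

theorem iterate_liftRen_comp (ρ ρ' : ℕ → ℕ) (n : ℕ) :
    liftRen^[n] ρ' ∘ liftRen^[n] ρ = liftRen^[n] (ρ' ∘ ρ) := by
  induction n with
  | zero => rfl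
  | succ n ih => simp only [Function.iterate_succ_apply', liftRen_comp, ih]

theorem rename_rename (ρ ρ' : ℕ → ℕ) (t : Term) :
    (t.rename ρ).rename ρ' = t.rename (ρ' ∘ ρ) := by
  induction t generalizing ρ ρ' with
  | var i => rfl
  | app t u ht hu => simp only [rename, ht, hu]
  | con c n args h => simp only [rename, h]
  | lam t ht => simp only [rename, ht, liftRen_comp]
  | case t cs ar b ht hb => simp only [rename, ht, hb, iterate_liftRen_comp]

theorem liftSub_comp_liftRen (ρ : ℕ → ℕ) (σ : ℕ → Term) :
    liftSub σ ∘ liftRen ρ = liftSub (σ ∘ ρ) := by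
  funext i
  cases i <;> rfl

theorem iterate_liftSub_comp_liftRen (ρ : ℕ → ℕ) (σ : ℕ → Term) (n : ℕ) :
    liftSub^[n] σ ∘ liftRen^[n] ρ = liftSub^[n] (σ ∘ ρ) := by
  induction n with
  | zero => rfl
  | succ n ih => simp only [Function.iterate_succ_apply', liftSub_comp_liftRen, ih]

theorem subst_rename (ρ : ℕ → ℕ) (σ : ℕ → Term) (t : Term) :
    (t.rename ρ).subst σ = t.subst (σ ∘ ρ) := by
  induction t generalizing ρ σ with
  | var i => rfl
  | app t u ht hu => simp only [rename, subst, ht, hu]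
  | con c n args h => simp only [rename, subst, h]
  | lam t ht => simp only [rename, subst, ht, liftSub_comp_liftRen]
  | case t cs ar b ht hb => simp only [rename, subst, ht, hb, iterate_liftSub_comp_liftRen]

theorem liftSub_rename (ρ : ℕ → ℕ) (σ : ℕ → Term) :
    (fun i => (liftSub σ i).rename (liftRen ρ)) = liftSub (fun i => (σ i).rename ρ) := by
  funext i
  cases i with
  | zero => rfl
  | succ i =>
    simp only [liftSub, rename_rename]
    rfl

theorem iterate_liftSub_rename (ρ : ℕ → ℕ) (σ : ℕ → Term) (n : ℕ) :
    (fun i => (liftSub^[n] σ i).rename (liftRen^[n] ρ)) =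
      liftSub^[n] (fun i => (σ i).rename ρ) := by
  induction n with
  | zero => rfl
  | succ n ih => simp only [Function.iterate_succ_apply', liftSub_rename, ih]

theorem rename_subst (ρ : ℕ → ℕ) (σ : ℕ → Term) (t : Term) :
    (t.subst σ).rename ρ = t.subst (fun i => (σ i).rename ρ) := by
  induction t generalizing ρ σ with
  | var i => rfl
  | app t u ht hu => simp only [rename, subst, ht, hu]
  | con c n args h => simp only [rename, subst, h]
  | lam t ht => simp only [rename, subst, ht, liftSub_rename]
  | case t cs ar b ht hb => simp only [rename, subst, ht, hb, iterate_liftSub_rename]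

theorem liftSub_subst (σ τ : ℕ → Term) :
    (fun i => (liftSub σ i).subst (liftSub τ)) = liftSub (fun i => (σ i).subst τ) := by
  funext i
  cases i with
  | zero => rfl
  | succ i =>
    simp only [liftSub, subst_rename, rename_subst]
    rfl

theorem iterate_liftSub_subst (σ τ : ℕ → Term) (n : ℕ) :
    (fun i => (liftSub^[n] σ i).subst (liftSub^[n] τ)) =
      liftSub^[n] (fun i => (σ i).subst τ) := by
  induction n with
  | zero => rfl
  | succ n ih => simp only [Function.iterate_succ_apply', liftSub_subst, ih]

/-- Going under a binder renames the terms being substituted, so both mixed laws, `subst_rename` and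
`rename_subst`, are needed to commute the two lifts. -/
theorem subst_subst (σ τ : ℕ → Term) (t : Term) :
    (t.subst σ).subst τ = t.subst (fun i => (σ i).subst τ) := by
  induction t generalizing σ τ with
  | var i => rfl
  | app t u ht hu => simp only [subst, ht, hu]
  | con c n args h => simp only [subst, h]
  | lam t ht => simp only [subst, ht, liftSub_subst]
  | case t cs ar b ht hb => simp only [subst, ht, hb, iterate_liftSub_subst]

theorem liftSub_var : liftSub var = var := by
  funext i
  cases i <;> rfl

theorem iterate_liftSub_var (n : ℕ) : liftSub^[n] var = var :=
  Function.iterate_fixed liftSub_var n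

theorem subst_var (t : Term) : t.subst var = t := by
  induction t with
  | var i => rfl
  | app t u ht hu => simp only [subst, ht, hu]
  | con c n args h => simp only [subst, h]
  | lam t ht => simp only [subst, liftSub_var, ht]
  | case t cs ar b ht hb => simp only [subst, ht, hb, iterate_liftSub_var]

/-- `P` stands for being free in the body under the `n` binders. It is generalized because each
binder shifts it by one. -/
theorem iterate_liftSub_congr {σ τ : ℕ → Term} {P : ℕ → Prop} (n : ℕ)
    (h : ∀ i, P (i + n) → σ i = τ i) (i : ℕ) (hi : P i) :
    liftSub^[n] σ i = liftSub^[n] τ i := by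
  induction n generalizing P i with
  | zero => exact h i hi
  | succ n ih =>
    simp only [Function.iterate_succ_apply']
    cases i with
    | zero => rfl
    | succ i => exact congrArg _ (ih (P := fun i => P (i + 1)) h i hi)

theorem subst_congr {σ τ : ℕ → Term} (t : Term) (h : ∀ i ∈ t.FV, σ i = τ i) :
    t.subst σ = t.subst τ := by
  induction t generalizing σ τ with
  | var i => exact h i rfl
  | app t u ht hu =>
    simp only [subst, ht fun i hi => h i (Or.inl hi), hu fun i hi => h i (Or.inr hi)]
  | con c n args ih =>
    simp only [subst, fun j => ih j fun i hi => h i (Set.mem_iUnion.2 ⟨j, hi⟩)]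
  | lam t ht =>
    exact congrArg lam (ht (iterate_liftSub_congr (P := (· ∈ t.FV)) 1 h))
  | case t cs ar b ht hb =>
    simp only [subst, ht fun i hi => h i (Or.inl hi)]
    congr 1
    funext c
    exact hb c (iterate_liftSub_congr (P := (· ∈ (b c).FV)) (ar c + 1)
      fun i hi => h i (Or.inr (Set.mem_iUnion.2 ⟨c, hi⟩)))

/-- The substitution that replaces the variables `0, 1, …` by the members of a list and the
variables after them according to `γ`. -/
def appendSub : List Term → (ℕ → Term) → ℕ → Term
  | [], γ, i => γ i
  | v :: _, _, 0 => v
  | _ :: vs, γ, i + 1 => appendSub vs γ i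

theorem inst_eq_appendSub (vs : List Term) : inst vs = appendSub vs var := by
  induction vs with
  | nil => rfl
  | cons v vs ih =>
    funext i
    cases i with
    | zero => rfl
    | succ i => exact congrFun ih i

/-- The weakening introduced by each lift is cancelled when the corresponding member of the list is
consumed. This turns a substitution followed by a reduction into one extended substitution, the form
in which hypotheses about open bodies apply. -/
theorem iterate_liftSub_subst_inst (vs : List Term) (γ : ℕ → Term) (i : ℕ) :
    (liftSub^[vs.length] γ i).subst (inst vs) = appendSub vs γ i := by
  induction vs generalizing i with
  | nil => exact subst_var _
  | cons v vs ih =>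
    rw [List.length_cons, Function.iterate_succ_apply']
    cases i with
    | zero => rfl
    | succ i => exact (subst_rename _ _ _).trans (ih i)

theorem subst_iterate_liftSub_inst (vs : List Term) (γ : ℕ → Term) (t : Term) :
    (t.subst (liftSub^[vs.length] γ)).subst (inst vs) = t.subst (appendSub vs γ) := by
  rw [subst_subst]
  exact congrArg (subst · t) (funext (iterate_liftSub_subst_inst vs γ))

theorem subst_liftSub_inst (v : Term) (γ : ℕ → Term) (t : Term) :
    (t.subst (liftSub γ)).subst (inst [v]) = t.subst (appendSub [v] γ) :=
  subst_iterate_liftSub_inst [v] γ t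

theorem appendSub_congr (vs : List Term) (γ δ : ℕ → Term) (i : ℕ) (hi : i < vs.length) :
    appendSub vs γ i = appendSub vs δ i := by
  induction vs generalizing i with
  | nil => simp at hi
  | cons v vs ih =>
    cases i with
    | zero => rfl
    | succ i => exact ih i (by simpa using hi)

theorem appendSub_append (vs ws : List Term) (γ : ℕ → Term) :
    appendSub (vs ++ ws) γ = appendSub vs (appendSub ws γ) := by
  induction vs with
  | nil => rfl
  | cons v vs ih =>
    funext i
    cases i with
    | zero => rfl
    | succ i => exact congrFun ih i

/-- No free variable of `l` reaches past the list into `γ`. This makes a branch independent of the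
place where it is evaluated. -/
theorem subst_appendSub_of_FV_subset {n : ℕ} {l : Term} (hl : l.FV ⊆ Set.Iio n)
    (vs : Fin n → Term) (γ : ℕ → Term) :
    l.subst (appendSub (List.ofFn vs).reverse γ) = l.subst (inst (List.ofFn vs).reverse) := by
  rw [inst_eq_appendSub]
  exact subst_congr l fun i hi => appendSub_congr _ _ _ i (by simpa using hl hi)

/-- Of the `n + 1` lifts, the outermost belongs to the abstraction of the branch itself; the other
`n` are consumed by the pattern variables. -/
theorem subst_lam_iterate_liftSub {n : ℕ} (b : Term) (vs : Fin n → Term) (γ : ℕ → Term) :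
    (lam (b.subst (liftSub^[n + 1] γ))).subst (inst (List.ofFn vs).reverse) =
      (lam b).subst (appendSub (List.ofFn vs).reverse γ) := by
  rw [← subst_iterate_liftSub_inst, List.length_reverse, List.length_ofFn,
    Function.iterate_succ_apply']
  rfl

/-! ### Evaluation -/

theorem Value.not_step {v u : Term} (hv : Value v) : ¬ Step v u := by
  induction hv generalizing u with
  | lam t => rintro ⟨⟩
  | con c n args h ih =>
    intro hs
    cases hs with
    | con _ hs => exact ih _ hs

/-- Evaluation in a given number of steps. -/
inductive Steps : ℕ → Term → Term → Prop
  | refl {t : Term} : Steps 0 t t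
  | head {m : ℕ} {t u v : Term} : Step t u → Steps m u v → Steps (m + 1) t v

theorem exists_steps_of_reflTransGen {t v : Term} (h : Relation.ReflTransGen Step t v) :
    ∃ m, Steps m t v := by
  induction h using Relation.ReflTransGen.head_induction_on with
  | refl => exact ⟨0, .refl⟩
  | head hs _ ih =>
    obtain ⟨m, hm⟩ := ih
    exact ⟨m + 1, .head hs hm⟩

theorem Steps.eq_of_value {m : ℕ} {t v : Term} (h : Steps m t v) (ht : Value t) :
    m = 0 ∧ t = v := by
  cases h with
  | refl => exact ⟨rfl, rfl⟩
  | head hs _ => exact absurd hs ht.not_step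

/-- The exact count matters: the extra `+ 1` is the beta step, which pays for the strict decrease of
the index at arrows. -/
theorem Steps.app_inv {m : ℕ} {t u v : Term} (h : Steps m (app t u) v) (hv : Value v) :
    ∃ m₁ m₂ m₃ f w, Steps m₁ t (lam f) ∧ Steps m₂ u w ∧ Value w ∧
      Steps m₃ (f.subst (inst [w])) v ∧ m = m₁ + m₂ + m₃ + 1 := by
  induction m generalizing t u with
  | zero =>
    cases h
    cases hv
  | succ m ih =>
    cases h with
    | head hs h =>
      cases hs with
      | appL hs =>
        obtain ⟨m₁, m₂, m₃, f, w, h₁, h₂, hw, h₃, rfl⟩ := ih h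
        exact ⟨m₁ + 1, m₂, m₃, f, w, .head hs h₁, h₂, hw, h₃, by omega⟩
      | appR _ hs =>
        obtain ⟨m₁, m₂, m₃, f, w, h₁, h₂, hw, h₃, rfl⟩ := ih h
        exact ⟨m₁, m₂ + 1, m₃, f, w, h₁, .head hs h₂, hw, h₃, by omega⟩
      | beta hw => exact ⟨0, 0, m, _, _, .refl, .refl, hw, h, by omega⟩

theorem Steps.case_inv {m : ℕ} {t v : Term} {cs : Finset ConName} {ar : cs → ℕ} {b : cs → Term}
    (h : Steps m (case t cs ar b) v) (hv : Value v) :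
    ∃ (m₁ m₂ : ℕ) (c : cs) (args : Fin (ar c) → Term),
      Steps m₁ t (con c (ar c) args) ∧ (∀ j, Value (args j)) ∧
      Steps m₂ ((lam (b c)).subst (inst (List.ofFn args).reverse)) v ∧ m = m₁ + m₂ + 1 := by
  induction m generalizing t with
  | zero =>
    cases h
    cases hv
  | succ m ih =>
    cases h with
    | head hs h =>
      cases hs with
      | scrut hs =>
        obtain ⟨m₁, m₂, c, args, h₁, ha, h₂, rfl⟩ := ih h
        exact ⟨m₁ + 1, m₂, c, args, .head hs h₁, ha, h₂, by omega⟩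
      -- The remaining rule is the match step: the scrutinee is already a value.
      | _ => exact ⟨0, m, _, _, .refl, ‹_›, h, by omega⟩

theorem Steps.con_inv {m : ℕ} {c : ConName} {n : ℕ} {args : Fin n → Term} {v : Term}
    (h : Steps m (con c n args) v) (hv : Value v) :
    ∃ vs : Fin n → Term, v = con c n vs ∧
      ∀ j, Value (vs j) ∧ ∃ m' ≤ m, Steps m' (args j) (vs j) := by
  induction m generalizing args with
  | zero =>
    cases h
    cases hv with
    | con _ _ _ ha => exact ⟨args, rfl, fun j => ⟨ha j, 0, le_rfl, .refl⟩⟩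
  | succ m ih =>
    cases h with
    | head hs h =>
      cases hs with
      | @con _ _ _ i a _ hs =>
        obtain ⟨vs, rfl, hvs⟩ := ih h
        refine ⟨vs, rfl, fun j => ⟨(hvs j).1, ?_⟩⟩
        obtain ⟨m', hm', hj⟩ := (hvs j).2
        by_cases hji : j = i
        · subst hji
          rw [Function.update_self] at hj
          exact ⟨m' + 1, by omega, .head hs hj⟩
        · rw [Function.update_of_ne hji] at hj
          exact ⟨m', by omega, hj⟩

open Relation in
theorem reflTransGen_appL {t t' u : Term} (h : ReflTransGen Step t t') :
    ReflTransGen Step (app t u) (app t' u) :=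
  h.lift (app · u) fun _ _ => .appL

open Relation in
theorem reflTransGen_beta {f u v : Term} (h : ReflTransGen Step u v) (hv : Value v) :
    ReflTransGen Step (app (lam f) u) (f.subst (inst [v])) :=
  (h.lift (app (lam f)) fun _ _ => .appR (.lam f)).tail (.beta hv)

open Relation in
theorem reflTransGen_match {t : Term} {cs : Finset ConName} {ar : cs → ℕ} {b : cs → Term} {c : cs}
    {args : Fin (ar c) → Term} (h : ReflTransGen Step t (con c (ar c) args))
    (ha : ∀ j, Value (args j)) :
    ReflTransGen Step (case t cs ar b) ((lam (b c)).subst (inst (List.ofFn args).reverse)) :=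
  (h.lift (case · cs ar b) fun _ _ => .scrut).tail (.match c ha)

open Relation in
theorem reflTransGen_con {c : ConName} {n : ℕ} {args vs : Fin n → Term}
    (h : ∀ j, ReflTransGen Step (args j) (vs j)) (hv : ∀ j, Value (vs j)) :
    ReflTransGen Step (con c n args) (con c n vs) := by
  -- Evaluation goes from left to right, so an intermediate stage has its first `k` arguments
  -- evaluated and the others untouched.
  have key : ∀ k ≤ n, ReflTransGen Step (con c n args)
      (con c n fun j => if j.val < k then vs j else args j) := by
    intro k
    induction k with
    | zero => simp [ReflTransGen.refl]
    | succ k ih =>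
      intro hk
      refine (ih (by omega)).trans ?_
      let i : Fin n := ⟨k, hk⟩
      let p : Fin n → Term := fun j => if j.val < k then vs j else args j
      have hstep : ∀ a a', Step a a' →
          Step (con c n (Function.update p i a)) (con c n (Function.update p i a')) := by
        intro a a' hs
        have := Step.con (c := c) (args := Function.update p i a) (i := i) (a := a')
          (fun j hj => by
            have hjk : j.val < k := hj
            rw [Function.update_of_ne hj.ne]
            simpa [p, hjk] using hv j)
          (by rwa [Function.update_self])
        rwa [Function.update_idem] at this
      have hrun : ReflTransGen Step (con c n (Function.update p i (args i)))
          (con c n (Function.update p i (vs i))) := (h i).lift _ hstep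
      have h₁ : Function.update p i (args i) = p := by
        rw [Function.update_eq_self_iff]
        simp [p, i]
      have h₂ : Function.update p i (vs i) = fun j => if j.val < k + 1 then vs j else args j := by
        funext j
        by_cases hj : j = i
        · subst hj
          simp [i]
        · rw [Function.update_of_ne hj]
          have : j.val ≠ k := fun e => hj (Fin.ext e)
          have : j.val < k ↔ j.val < k + 1 := by omega
          simp only [p, this]
      rw [h₁, h₂] at hrun
      exact hrun
  simpa using key n le_rfl

open Relation in
-- The first argument meets the outermost abstraction and so gets the largest index, hence the
-- reversed list. Each beta step absorbs one value into `σ`, over which the induction is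
-- generalized.
theorem reflTransGen_foldl_app {ts vs : List Term}
    (h : List.Forall₂ (fun t v => ReflTransGen Step t v ∧ Value v) ts vs)
    (l : Term) (σ : ℕ → Term) (t : Term)
    (ht : ReflTransGen Step t ((lam^[ts.length] l).subst σ)) :
    ReflTransGen Step (ts.foldl app t) (l.subst (appendSub vs.reverse σ)) := by
  induction h generalizing σ t with
  | nil => exact ht
  | @cons u v ts vs hu _ ih =>
    rw [List.foldl_cons, List.reverse_cons, appendSub_append]
    apply ih
    rw [List.length_cons, Function.iterate_succ_apply'] at ht
    rw [← subst_liftSub_inst]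
    exact (reflTransGen_appL ht).trans (reflTransGen_beta hu.1 hu.2)

theorem subst_foldl_app (ts : List Term) (t : Term) (σ : ℕ → Term) :
    (ts.foldl app t).subst σ = (ts.map (subst σ)).foldl app (t.subst σ) := by
  induction ts generalizing t with
  | nil => rfl
  | cons u ts ih => exact ih _

theorem reflTransGen_lets {n : ℕ} {ts vs : Fin n → Term} {l : Term} (hl : l.FV ⊆ Set.Iio n)
    {σ : ℕ → Term} (h : ∀ j, Relation.ReflTransGen Step ((ts j).subst σ) (vs j))
    (hv : ∀ j, Value (vs j)) :
    Relation.ReflTransGen Step ((lets n ts l).subst σ)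
      (l.subst (inst (List.ofFn vs).reverse)) := by
  rw [← subst_appendSub_of_FV_subset hl vs σ, lets, subst_foldl_app]
  refine reflTransGen_foldl_app ?_ l σ _ ?_
  · rw [List.map_ofFn, List.forall₂_iff_get]
    refine ⟨by simp, fun i h₁ h₂ => ?_⟩
    simpa using ⟨h _, hv _⟩
  · simp [Relation.ReflTransGen.refl]

end Term

open Term Relation

/-! ### The logical relation -/

/-- Relatedness of values under a strategy, given the relations `R j` for the indices `j < k`. -/
inductive ValRelStep (k : ℕ) (R : (j : ℕ) → j < k → Strat 0 → Term → Term → Prop) :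
    Strat 0 → Term → Term → Prop
  | top {v v' : Term} : Value v → Value v' → ValRelStep k R .top v v'
  -- Unfolding keeps the index, which is harmless because the relation at a fixed index is a least
  -- fixed point. Likewise `bot` has no rule and relates nothing.
  | mu {F : Strat 1} {v v' : Term} :
      ValRelStep k R (F.apply (.mu F)) v v' → ValRelStep k R (.mu F) v v'
  | arr {S T : Strat 0} {t t' : Term} :
      (∀ j (hj : j < k) (w w' : Term), R j hj S w w' → ∀ m (_ : m ≤ j) (u : Term),
        Steps m (t.subst (inst [w])) u → Value u →
        ∃ u', ReflTransGen Step (t'.subst (inst [w'])) u' ∧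
          R (j - m) (lt_of_le_of_lt (Nat.sub_le j m) hj) T u u') →
      ValRelStep k R (.arr S T) (.lam t) (.lam t')
  | data {cs : Finset ConName} {ar : cs → ℕ} {S : (c : cs) → Fin (ar c) → Strat 0} (c : cs)
      {vs vs' : Fin (ar c) → Term} :
      (∀ i, Value (vs i)) → (∀ i, Value (vs' i)) →
      (∀ j (hj : j < k) i, R j hj (S c i) (vs i) (vs' i)) →
      ValRelStep k R (.data cs ar S) (.con c (ar c) vs) (.con c (ar c) vs')
  | fuse {cs : Finset ConName} {ar : cs → ℕ} {S : (c : cs) → Fin (ar c) → Strat 0}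
      {b : cs → Term} (c : cs) {vs vs' : Fin (ar c) → Term} :
      (∀ i, Value (vs i)) → (∀ i, Value (vs' i)) →
      (∀ j (hj : j < k) i, R j hj (S c i) (vs i) (vs' i)) →
      ValRelStep k R (.fuse cs ar S b) (.con c (ar c) vs)
        ((Term.lam (b c)).subst (inst (List.ofFn vs').reverse))

/-- Relatedness of values under a strategy, for `k` steps of evaluation of the first one. -/
def ValRel (k : ℕ) : Strat 0 → Term → Term → Prop :=
  ValRelStep k fun j _ => ValRel j
termination_by k

/-- Relatedness of terms under a strategy, for `k` steps of evaluation of the first one. -/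
def TermRel (k : ℕ) (S : Strat 0) (t t' : Term) : Prop :=
  ∀ m ≤ k, ∀ v, Steps m t v → Value v → ∃ v', ReflTransGen Step t' v' ∧ ValRel (k - m) S v v'

theorem ValRel_eq (k : ℕ) : ValRel k = ValRelStep k fun j _ => ValRel j := by
  rw [ValRel]

/-! ### Monotonicity and inversion of the logical relation -/

namespace ValRel

theorem value {k : ℕ} {S : Strat 0} {v v' : Term} (h : ValRel k S v v') : Value v ∧ Value v' := by
  rw [ValRel_eq] at h
  induction h with
  | top h h' => exact ⟨h, h'⟩
  | mu _ ih => exact ih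
  | arr _ => exact ⟨.lam _, .lam _⟩
  | data c h h' _ => exact ⟨.con _ _ _ h, .con _ _ _ h'⟩
  -- Branches are syntactically abstractions, so an instantiated branch is a value.
  | fuse c h _ _ => exact ⟨.con _ _ _ h, .lam _⟩

/-- The index only bounds the range of `j`, and the relations at those `j` do not depend on it; no
induction on the index is needed. -/
theorem mono {k j : ℕ} (hj : j ≤ k) {S : Strat 0} {v v' : Term} (h : ValRel k S v v') :
    ValRel j S v v' := by
  rw [ValRel_eq] at h ⊢
  induction h with
  | top h h' => exact .top h h'
  | mu _ ih => exact .mu ih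
  | arr h => exact .arr fun i hi => h i (hi.trans_le hj)
  | data c h h' hR => exact .data c h h' fun i hi => hR i (hi.trans_le hj)
  | fuse c h h' hR => exact .fuse c h h' fun i hi => hR i (hi.trans_le hj)

theorem top {k : ℕ} {v v' : Term} (h : Value v) (h' : Value v') : ValRel k .top v v' := by
  rw [ValRel_eq]
  exact .top h h'

theorem mu_iff {k : ℕ} {F : Strat 1} {v v' : Term} :
    ValRel k (.mu F) v v' ↔ ValRel k (F.apply (.mu F)) v v' := by
  rw [ValRel_eq]
  refine ⟨fun h => ?_, .mu⟩
  cases h with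
  | mu h => exact h

/-- The premise of `ValRelStep.arr` is `TermRel` written out, as `TermRel` itself presupposes
`ValRel`. -/
theorem arr {k : ℕ} {S T : Strat 0} {t t' : Term}
    (h : ∀ j < k, ∀ w w', ValRel j S w w' →
      TermRel j T (t.subst (inst [w])) (t'.subst (inst [w']))) :
    ValRel k (.arr S T) (.lam t) (.lam t') := by
  rw [ValRel_eq]
  exact .arr h

theorem arr_inv {k : ℕ} {S T : Strat 0} {v v' : Term} (h : ValRel k (.arr S T) v v') :
    ∃ t t', v = .lam t ∧ v' = .lam t' ∧ ∀ j < k, ∀ w w', ValRel j S w w' →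
      TermRel j T (t.subst (inst [w])) (t'.subst (inst [w'])) := by
  rw [ValRel_eq] at h
  cases h with
  | arr h => exact ⟨_, _, rfl, rfl, h⟩

theorem data_inv {k : ℕ} {cs : Finset ConName} {ar : cs → ℕ}
    {S : (c : cs) → Fin (ar c) → Strat 0} {c : cs} {vs : Fin (ar c) → Term} {v' : Term}
    (h : ValRel k (.data cs ar S) (.con c (ar c) vs) v') :
    ∃ vs' : Fin (ar c) → Term, v' = .con c (ar c) vs' ∧ (∀ i, Value (vs' i)) ∧
      ∀ j < k, ∀ i, ValRel j (S c i) (vs i) (vs' i) := by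
  rw [ValRel_eq] at h
  generalize hv : Term.con c (ar c) vs = v at h
  cases h with
  | data c₂ _ h' hR =>
    injection hv with hc hn ha
    -- The constructor name determines the member of `cs`, and with it the arity and the field
    -- strategies.
    obtain rfl := Subtype.ext hc
    obtain rfl := eq_of_heq ha
    exact ⟨_, rfl, h', hR⟩

theorem fuse_inv {k : ℕ} {cs : Finset ConName} {ar : cs → ℕ}
    {S : (c : cs) → Fin (ar c) → Strat 0} {b : cs → Term} {c : cs} {vs : Fin (ar c) → Term}
    {v' : Term} (h : ValRel k (.fuse cs ar S b) (.con c (ar c) vs) v') :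
    ∃ vs' : Fin (ar c) → Term,
      v' = (Term.lam (b c)).subst (inst (List.ofFn vs').reverse) ∧
      ∀ j < k, ∀ i, ValRel j (S c i) (vs i) (vs' i) := by
  rw [ValRel_eq] at h
  generalize hv : Term.con c (ar c) vs = v at h
  cases h with
  | fuse c₂ _ _ hR =>
    injection hv with hc hn ha
    obtain rfl := Subtype.ext hc
    obtain rfl := eq_of_heq ha
    exact ⟨_, rfl, hR⟩

theorem termRel {k : ℕ} {S : Strat 0} {v v' : Term} (h : ValRel k S v v') :
    TermRel k S v v' := by
  intro m _ u hs _
  obtain ⟨rfl, rfl⟩ := hs.eq_of_value h.value.1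
  exact ⟨v', .refl, h⟩

end ValRel

theorem TermRel.imp {k : ℕ} {S T : Strat 0} {t t' : Term}
    (hST : ∀ j v v', ValRel j S v v' → ValRel j T v v') (h : TermRel k S t t') :
    TermRel k T t t' := by
  intro m hm v hs hv
  obtain ⟨v', hs', hR⟩ := h m hm v hs hv
  exact ⟨v', hs', hST _ _ _ hR⟩

/-- Evaluated arguments of a constructor, related to evaluated arguments on the other side. -/
theorem TermRel.con_inv {k m n : ℕ} (hm : m ≤ k) {S : Fin n → Strat 0} {ts ts' : Fin n → Term}
    (h : ∀ i, TermRel k (S i) (ts i) (ts' i)) {c : ConName} {v : Term}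
    (hs : Steps m (.con c n ts) v) (hv : Value v) :
    ∃ vs vs' : Fin n → Term, v = .con c n vs ∧ (∀ i, ReflTransGen Step (ts' i) (vs' i)) ∧
      ∀ i, ValRel (k - m) (S i) (vs i) (vs' i) := by
  obtain ⟨vs, rfl, hvs⟩ := hs.con_inv hv
  have key : ∀ i, ∃ v', ReflTransGen Step (ts' i) v' ∧ ValRel (k - m) (S i) (vs i) v' := by
    intro i
    obtain ⟨hvi, m', hm', hsi⟩ := hvs i
    obtain ⟨v', hs', hR⟩ := h i m' (hm'.trans hm) _ hsi hvi
    -- Each argument takes at most the `m` steps of the whole, so all fields can be weakened to the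
    -- common index `k - m`.
    exact ⟨v', hs', hR.mono (by omega)⟩
  choose vs' hs' hR using key
  exact ⟨vs, vs', rfl, hs', hR⟩

/-- Relatedness of substitutions under a strategy context. -/
def SubstRel (k : ℕ) (Γ : List (Strat 0)) (γ γ' : ℕ → Term) : Prop :=
  ∀ i S, Γ[i]? = some S → ValRel k S (γ i) (γ' i)

namespace SubstRel

theorem mono {k j : ℕ} (hj : j ≤ k) {Γ : List (Strat 0)} {γ γ' : ℕ → Term}
    (h : SubstRel k Γ γ γ') : SubstRel j Γ γ γ' :=
  fun i S hi => (h i S hi).mono hj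

theorem cons {k : ℕ} {Γ : List (Strat 0)} {γ γ' : ℕ → Term} (h : SubstRel k Γ γ γ')
    {S : Strat 0} {v v' : Term} (hv : ValRel k S v v') :
    SubstRel k (S :: Γ) (appendSub [v] γ) (appendSub [v'] γ') := by
  intro i T hi
  cases i with
  | zero =>
    obtain rfl : S = T := by simpa using hi
    exact hv
  | succ i => exact h i T (by simpa using hi)

theorem extend {k n : ℕ} {Γ : List (Strat 0)} {γ γ' : ℕ → Term} (h : SubstRel k Γ γ γ')
    {S : Fin n → Strat 0} {vs vs' : Fin n → Term} (hv : ∀ i, ValRel k (S i) (vs i) (vs' i)) :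
    SubstRel k (extend Γ S) (appendSub (List.ofFn vs).reverse γ)
      (appendSub (List.ofFn vs').reverse γ') := by
  induction n with
  | zero => simpa [Fusion.extend, appendSub] using h
  | succ n ih =>
    -- The last pattern variable is bound most recently, so it is the one to split off.
    have hn := (ih fun i => hv i.castSucc).cons (hv (Fin.last n))
    simp only [← appendSub_append] at hn
    simpa [Fusion.extend, List.ofFn_succ', List.concat_eq_append, -List.ofFn_succ] using hn

end SubstRel

/-- Semantic counterpart of `Γ ⊢ t ⇝ t' ⇐ S`. -/
def SemFuses (Γ : List (Strat 0)) (t t' : Term) (S : Strat 0) : Prop :=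
  ∀ k γ γ', SubstRel k Γ γ γ' → TermRel k S (t.subst γ) (t'.subst γ')

/-! ### Compatibility of the relation with the fusion rules -/

namespace SemFuses

variable {Γ : List (Strat 0)}

theorem var {i : ℕ} {S : Strat 0} (h : Γ[i]? = some S) : SemFuses Γ (.var i) (.var i) S :=
  fun _ _ _ hγ => (hγ i S h).termRel

theorem lam {t t' : Term} {S' S : Strat 0} (h : SemFuses (S' :: Γ) t t' S) :
    SemFuses Γ (.lam t) (.lam t') (.arr S' S) := by
  refine fun k γ γ' hγ => (ValRel.arr fun j hj w w' hw => ?_).termRel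
  rw [subst_liftSub_inst, subst_liftSub_inst]
  exact h j _ _ ((hγ.mono hj.le).cons hw)

theorem recFold {t t' : Term} {F : Strat 1} (h : SemFuses Γ t t' (F.apply (.mu F))) :
    SemFuses Γ t t' (.mu F) :=
  fun k γ γ' hγ => (h k γ γ' hγ).imp fun _ _ _ => ValRel.mu_iff.2

theorem recUnfold {t t' : Term} {F : Strat 1} (h : SemFuses Γ t t' (.mu F)) :
    SemFuses Γ t t' (F.apply (.mu F)) :=
  fun k γ γ' hγ => (h k γ γ' hγ).imp fun _ _ _ => ValRel.mu_iff.1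

theorem top {t t' : Term} {S : Strat 0} (h : SemFuses Γ t t' S) : SemFuses Γ t t' .top :=
  fun k γ γ' hγ => (h k γ γ' hγ).imp fun _ _ _ hv => .top hv.value.1 hv.value.2

theorem app {t₁ t₁' t₂ t₂' : Term} {S' S : Strat 0} (h₁ : SemFuses Γ t₁ t₁' (.arr S' S))
    (h₂ : SemFuses Γ t₂ t₂' S') : SemFuses Γ (.app t₁ t₂) (.app t₁' t₂') S := by
  intro k γ γ' hγ m hm v hs hv
  obtain ⟨m₁, m₂, m₃, f, w, hs₁, hs₂, hw, hs₃, rfl⟩ := Steps.app_inv hs hv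
  obtain ⟨_, hs₁', hR₁⟩ := h₁ k γ γ' hγ m₁ (by omega) _ hs₁ (.lam f)
  obtain ⟨w', hs₂', hR₂⟩ := h₂ k γ γ' hγ m₂ (by omega) _ hs₂ hw
  obtain ⟨_, f', ⟨⟩, rfl, hf⟩ := hR₁.arr_inv
  -- This index is strictly below `k - m₁` because of the beta step, and it still leaves room for
  -- the `m₃` steps of the body.
  obtain ⟨v', hs₃', hR⟩ := hf (k - m₁ - m₂ - 1) (by omega) w w' (hR₂.mono (by omega)) m₃
    (by omega) v hs₃ hv
  refine ⟨v', ?_, hR.mono (by omega)⟩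
  exact (reflTransGen_appL hs₁').trans ((reflTransGen_beta hs₂' hR₂.value.2).trans hs₃')

variable {cs : Finset ConName} {ar : cs → ℕ} {S : (c : cs) → Fin (ar c) → Strat 0}

theorem ctor {b' : cs → Term} (c : cs) {t t' : Fin (ar c) → Term}
    (hb : (Term.lam (b' c)).FV ⊆ Set.Iio (ar c)) (h : ∀ j, SemFuses Γ (t j) (t' j) (S c j)) :
    SemFuses Γ (.con c (ar c) t) (lets (ar c) t' (.lam (b' c))) (.fuse cs ar S b') := by
  intro k γ γ' hγ m hm v hs hv
  obtain ⟨vs, vs', rfl, hs', hR⟩ := TermRel.con_inv hm (fun i => h i k γ γ' hγ) hs hv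
  refine ⟨_, reflTransGen_lets hb hs' fun i => (hR i).value.2, ?_⟩
  rw [ValRel_eq]
  exact .fuse c (fun i => (hR i).value.1) (fun i => (hR i).value.2)
    fun j hj i => (hR i).mono hj.le

theorem ctorSkip (c : cs) {t t' : Fin (ar c) → Term}
    (h : ∀ j, SemFuses Γ (t j) (t' j) (S c j)) :
    SemFuses Γ (.con c (ar c) t) (.con c (ar c) t') (.data cs ar S) := by
  intro k γ γ' hγ m hm v hs hv
  obtain ⟨vs, vs', rfl, hs', hR⟩ := TermRel.con_inv hm (fun i => h i k γ γ' hγ) hs hv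
  refine ⟨_, reflTransGen_con hs' fun i => (hR i).value.2, ?_⟩
  rw [ValRel_eq]
  exact .data c (fun i => (hR i).value.1) (fun i => (hR i).value.2)
    fun j hj i => (hR i).mono hj.le

/-- On the right no match happens: evaluating `t'` already yields the branch `b' c` on the fields.
The substitution `γ'` has not been applied to this branch, which is why `b' c` must be closed up to
its pattern variables. -/
theorem case {t t' : Term} {b b' : cs → Term} {T : Strat 0}
    (h : SemFuses Γ t t' (.fuse cs ar S b'))
    (hb : ∀ c, SemFuses (extend Γ (S c)) (.lam (b c)) (.lam (b' c)) T)
    (hb' : ∀ c, (Term.lam (b' c)).FV ⊆ Set.Iio (ar c)) :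
    SemFuses Γ (.case t cs ar b) t' T := by
  intro k γ γ' hγ m hm v hs hv
  obtain ⟨m₁, m₂, c, vs, hs₁, hvs, hs₂, rfl⟩ := Steps.case_inv hs hv
  obtain ⟨_, hs₁', hR₁⟩ := h k γ γ' hγ m₁ (by omega) _ hs₁ (.con _ _ _ hvs)
  obtain ⟨vs', rfl, hR⟩ := hR₁.fuse_inv
  rw [subst_lam_iterate_liftSub] at hs₂
  -- Fields are related strictly below `k - m₁`; the match step makes `k - m₁ - 1` sufficient.
  obtain ⟨v', hs₂', hR₂⟩ := hb c (k - m₁ - 1) _ _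
    ((hγ.mono (by omega)).extend (hR _ (by omega))) m₂ (by omega) v hs₂ hv
  rw [subst_appendSub_of_FV_subset (hb' c)] at hs₂'
  exact ⟨v', hs₁'.trans hs₂', hR₂.mono (by omega)⟩

theorem caseSkip {t t' : Term} {b b' : cs → Term} {T : Strat 0}
    (h : SemFuses Γ t t' (.data cs ar S))
    (hb : ∀ c, SemFuses (extend Γ (S c)) (.lam (b c)) (.lam (b' c)) T) :
    SemFuses Γ (.case t cs ar b) (.case t' cs ar b') T := by
  intro k γ γ' hγ m hm v hs hv
  obtain ⟨m₁, m₂, c, vs, hs₁, hvs, hs₂, rfl⟩ := Steps.case_inv hs hv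
  obtain ⟨_, hs₁', hR₁⟩ := h k γ γ' hγ m₁ (by omega) _ hs₁ (.con _ _ _ hvs)
  obtain ⟨vs', rfl, hvs', hR⟩ := hR₁.data_inv
  rw [subst_lam_iterate_liftSub] at hs₂
  obtain ⟨v', hs₂', hR₂⟩ := hb c (k - m₁ - 1) _ _
    ((hγ.mono (by omega)).extend (hR _ (by omega))) m₂ (by omega) v hs₂ hv
  refine ⟨v', ?_, hR₂.mono (by omega)⟩
  have hmatch := reflTransGen_match (b := fun c => (b' c).subst (Term.liftSub^[ar c + 1] γ'))
    hs₁' hvs'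
  rw [subst_lam_iterate_liftSub] at hmatch
  exact hmatch.trans hs₂'

theorem terminates {t t' : Term} {S : Strat 0} (h : SemFuses [] t t' S) (ht : t.Terminates) :
    t'.Terminates := by
  obtain ⟨v, hv, hs⟩ := ht
  obtain ⟨m, hs⟩ := exists_steps_of_reflTransGen hs
  -- The empty context constrains no variable, so identity substitutions will do. Index `m` covers
  -- the whole evaluation, and index `0` left at the end still guarantees a value.
  have hR := h m Term.var Term.var fun i S hi => by simp at hi
  rw [subst_var, subst_var] at hR
  obtain ⟨v', hs', hv'⟩ := hR m le_rfl v hs hv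
  exact ⟨v', hv'.value.2, hs'⟩

end SemFuses

theorem Fuses.semFuses {Γ : List (Strat 0)} {t t' : Term} {S : Strat 0} (h : Fuses Γ t t' S) :
    SemFuses Γ t t' S := by
  induction h with
  | var h => exact .var h
  | lam _ ih => exact .lam ih
  | recFold _ ih => exact .recFold ih
  | recUnfold _ ih => exact .recUnfold ih
  | app _ _ ih₁ ih₂ => exact .app ih₁ ih₂
  | ctor c hb _ ih => exact .ctor c hb ih
  | ctorSkip c _ ih => exact .ctorSkip c ih
  | case _ _ hFV ih ihb => exact .case ih ihb fun c => Set.subset_union_right.trans (hFV c)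
  | caseSkip _ _ ih ihb => exact .caseSkip ih ihb
  | top I _ ih => exact .top ih

/-! ### Typed terms and contexts -/

namespace Ty

theorem toStrat_rename {n m : ℕ} (ρ : Fin n → Fin m) (I : Ty n) :
    (I.rename ρ).toStrat = I.toStrat.rename ρ := by
  induction I generalizing m with
  | top => rfl
  | bot => rfl
  | rvar α => rfl
  | arr I J hI hJ => simp only [rename, toStrat, Strat.rename, hI, hJ]
  | mu F hF => simp only [rename, toStrat, Strat.rename, hF]
  | data cs ar I hI => simp only [rename, toStrat, Strat.rename, hI]

theorem toStrat_subst {n m : ℕ} (σ : Fin n → Ty m) (I : Ty n) :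
    (I.subst σ).toStrat = I.toStrat.subst (fun i => (σ i).toStrat) := by
  induction I generalizing m with
  | top => rfl
  | bot => rfl
  | rvar α => rfl
  | arr I J hI hJ => simp only [subst, toStrat, Strat.subst, hI, hJ]
  | mu F hF =>
    simp only [subst, toStrat, Strat.subst, hF]
    congr 2
    funext i
    refine Fin.cases rfl (fun i => ?_) i
    simp [liftSub, Strat.liftSub, toStrat_rename]
  | data cs ar I hI => simp only [subst, toStrat, Strat.subst, hI]

/-- Matches the folding rules for types, where substitution happens in `Ty`, with those for
strategies. -/
theorem toStrat_apply {n : ℕ} (F : Ty (n + 1)) (I : Ty n) :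
    (F.apply I).toStrat = F.toStrat.apply I.toStrat := by
  rw [apply, toStrat_subst, Strat.apply]
  congr 1
  funext i
  refine Fin.cases rfl (fun i => ?_) i
  rfl

end Ty

theorem map_extend {α β : Type} (f : α → β) (Γ : List α) {n : ℕ} (A : Fin n → α) :
    (extend Γ A).map f = extend (Γ.map f) (fun i => f (A i)) := by
  simp only [extend, List.map_append, List.map_reverse, List.map_ofFn]
  rfl

/-- Semantic approximation at a type. -/
abbrev SemApprox (Ξ : List (Ty 0)) (t t' : Term) (I : Ty 0) : Prop :=
  SemFuses (Ξ.map Ty.toStrat) t t' I.toStrat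

theorem SemApprox.recFold {Ξ : List (Ty 0)} {t t' : Term} {F : Ty 1}
    (h : SemApprox Ξ t t' (F.apply (.mu F))) : SemApprox Ξ t t' (.mu F) :=
  SemFuses.recFold (by rwa [SemApprox, Ty.toStrat_apply] at h)

theorem SemApprox.recUnfold {Ξ : List (Ty 0)} {t t' : Term} {F : Ty 1}
    (h : SemApprox Ξ t t' (.mu F)) : SemApprox Ξ t t' (F.apply (.mu F)) := by
  rw [SemApprox, Ty.toStrat_apply]
  exact SemFuses.recUnfold h

theorem SemApprox.case {Ξ : List (Ty 0)} {t t' : Term} {cs : Finset ConName} {ar : cs → ℕ}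
    {I' : (c : cs) → Fin (ar c) → Ty 0} {b b' : cs → Term} {I : Ty 0}
    (h : SemApprox Ξ t t' (.data cs ar I'))
    (hb : ∀ c, SemApprox (extend Ξ (I' c)) (.lam (b c)) (.lam (b' c)) I) :
    SemApprox Ξ (.case t cs ar b) (.case t' cs ar b') I := by
  refine SemFuses.caseSkip h fun c => ?_
  have hc := hb c
  rwa [SemApprox, map_extend] at hc

/-- Reflexivity at types: needed for the parts of a context that surround the hole. -/
theorem HasType.semApprox {Ξ : List (Ty 0)} {t : Term} {I : Ty 0} (h : HasType Ξ t I) :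
    SemApprox Ξ t t I := by
  induction h with
  | var h => exact .var (by simp [h])
  | lam _ ih => exact .lam ih
  | recFold _ ih => exact .recFold ih
  | recUnfold _ ih => exact .recUnfold ih
  | app _ _ ih₁ ih₂ => exact .app ih₁ ih₂
  | ctor c _ ih => exact .ctorSkip c ih
  | case _ _ ih ihb => exact .case ih ihb
  | top _ ih => exact .top ih

theorem SemApprox.rename {ρ : ℕ → ℕ} {Ξ Ξ' : List (Ty 0)} (hρ : Included ρ Ξ Ξ') {t t' : Term}
    {I : Ty 0} (h : SemApprox Ξ t t' I) : SemApprox Ξ' (t.rename ρ) (t'.rename ρ) I := by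
  intro k γ γ' hγ
  rw [subst_rename, subst_rename]
  refine h k _ _ fun i S hi => hγ (ρ i) S ?_
  rw [List.getElem?_map, Option.map_eq_some_iff] at hi ⊢
  obtain ⟨J, hJ, rfl⟩ := hi
  exact ⟨J, hρ.2 i J hJ, rfl⟩

/-! ### Plugging and closure under typed contexts -/

namespace Ctx

theorem plug_rename (C : Ctx) (ρ : ℕ → ℕ) (t : Term) :
    (C.rename ρ).plug t = (C.plug t).rename ρ := by
  induction C generalizing ρ with
  | hole ρ' => exact (rename_rename _ _ _).symm
  | appL C u ih => simp only [rename, plug, Term.rename, ih]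
  | appR u C ih => simp only [rename, plug, Term.rename, ih]
  | lam C ih => simp only [rename, plug, Term.rename, ih]
  | scrut C cs ar b ih => simp only [rename, plug, Term.rename, ih]
  | branch u cs ar b i C ih =>
    simp only [rename, plug, Term.rename, ih]
    congr 1
    funext c
    by_cases hc : c = i
    · subst hc
      simp only [Function.update_self]
    · simp only [Function.update_of_ne hc]
  | con c n args i C ih =>
    simp only [rename, plug, Term.rename, ih]
    congr 1
    funext j
    by_cases hj : j = i
    · subst hj
      simp only [Function.update_self]
    · simp only [Function.update_of_ne hj]

theorem plug_comp (C C₁ : Ctx) (t : Term) : (C.comp C₁).plug t = C.plug (C₁.plug t) := by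
  induction C with
  | hole ρ => exact plug_rename _ _ _
  | appL C u ih => simp only [comp, plug, ih]
  | appR u C ih => simp only [comp, plug, ih]
  | lam C ih => simp only [comp, plug, ih]
  | scrut C cs ar b ih => simp only [comp, plug, ih]
  | branch u cs ar b i C ih => simp only [comp, plug, ih]
  | con c n args i C ih => simp only [comp, plug, ih]

end Ctx

/-- Subterms beside the hole are related to themselves, and the compatibility lemmas rebuild the
rest. The terms are generalized because composition plugs an already filled inner context. -/
theorem CtxHasType.semApprox {Ξ Ξ' : List (Ty 0)} {C : Ctx} {I I' : Ty 0}
    (hC : CtxHasType Ξ' C Ξ I I') {t t' : Term} (h : SemApprox Ξ t t' I) :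
    SemApprox Ξ' (C.plug t) (C.plug t') I' := by
  induction hC generalizing t t' with
  | id hρ => exact h.rename hρ
  | app₁ _ hu ih => exact .app (ih h) hu.semApprox
  | app₂ hu _ ih => exact .app hu.semApprox (ih h)
  | lam _ ih => exact .lam (ih h)
  | case₁ _ hb ih => exact .case (ih h) fun c => (hb c).semApprox
  | @case₂ _ _ _ _ _ _ _ i _ _ _ hu hb _ ih =>
    refine .case hu.semApprox fun c => ?_
    by_cases hc : c = i
    · subst hc
      simp only [Function.update_self]
      exact ih h
    · simp only [Function.update_of_ne hc]
      exact (hb c hc).semApprox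
  | @ctor _ _ _ _ _ c _ i _ _ _ ha ih =>
    refine .ctorSkip c fun j => ?_
    by_cases hj : j = i
    · subst hj
      simp only [Function.update_self]
      exact ih h
    · simp only [Function.update_of_ne hj]
      exact (ha j hj).semApprox
  | recFold _ ih => exact .recFold (ih h)
  | recUnfold _ ih => exact .recUnfold (ih h)
  | comp _ _ ih ih₁ =>
    rw [Ctx.plug_comp, Ctx.plug_comp]
    exact ih (ih₁ h)

end Fusion

theorem mainTheorem1 (Ξ : List (Fusion.Ty 0)) (t t' : Fusion.Term) (I : Fusion.Ty 0)
    (h : Fusion.Fuses (Ξ.map Fusion.Ty.toStrat) t t' I.toStrat) :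
    Fusion.CtxApprox Ξ t t' I :=
  fun _ _ hC => (hC.semApprox h.semFuses).terminates
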